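/- Let $\mathcal H$ be a complex Hilbert space with scalar product $(\cdot,\cdot)_{\mathcal H}$ (linear in the second factor), and let $S$ be a densely defined, closed, symmetric operator in $\mathcal H$ with $S\ge\varepsilon I_{\mathcal H}$ for some $\varepsilon>0$, that is, $(u,Su)_{\mathcal H}\ge\varepsilon\|u\|_{\mathcal H}^2$ for $u\in\operatorname{dom}(S)$. For nonnegative self-adjoint operators $A,B$ write $A\le B$ if $\operatorname{dom}(B^{1/2})\subseteq\operatorname{dom}(A^{1/2})$ and $\|A^{1/2}u\|^2\le\|B^{1/2}u\|^2$ for all $u\in\operatorname{dom}(B^{1/2})$. The Krein–von Neumann extension $S_K$ of $S$ is the smallest nonnegative self-adjoint extension of $S$ in this order; it exists and is unique. Let $P$ be the orthogonal projection onto $\ker(S^*)$, put $\widehat{\mathcal H}=[I_{\mathcal H}-P]\mathcal H=[\ker(S^*)]^\perp$, and let $\widehat S_K=[I_{\mathcal H}-P]S_K[I_{\mathcal H}-P]$ in $\widehat{\mathcal H}$, with domain $\operatorname{dom}(S_K)\cap\widehat{\mathcal H}$. Let $\mathcal W$ be the Hilbert space $\operatorname{dom}(S)$ with the scalar product $(u,v)_{\mathcal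 W}=(Su,Sv)_{\mathcal H}$, and let the abstract buckling problem operator $T$ be the bounded operator in $\mathcal W$ determined by $$(w_1,Tw_2)_{\mathcal W}=(w_1,Sw_2)_{\mathcal H},\qquad w_1,w_2\in\mathcal W.$$ Theorem 3.4. One has $\ker(S_K)=\ker(S^*)$, so that $\widehat S_K$ is the restriction of $S_K$ to $[\ker(S_K)]^\perp$, and $\widehat S_K$ is injective. The operator $T$ is self-adjoint and nonnegative, the map $\widehat S:\mathcal W\to\widehat{\mathcal H}$, $w\mapsto Sw$, is unitary (onto $\widehat{\mathcal H}$), and the inverse of $\widehat S_K$, which is defined on all of $\widehat{\mathcal H}$, is unitarily equivalent to $T$: $$(\widehat S_K)^{-1}=\widehat S\,T\,(\widehat S)^{-1}.$$ Moreover, $|S|=(S^*S)^{1/2}$ satisfies $|S|\ge\varepsilon I_{\mathcal H}$ and has an inverse defined on all of $\mathcal H$, there is a polar decomposition $S=U_S|S|$ with $U_S:\mathcal H\to\widehat{\mathcal H}$ unitary, the operator $|S|^{-1}S|S|^{-1}$ is defined on all of $\mathcal H$, bounded and self-adjoint, and $$(\widehat S_K)^{-1}=U_S\bigl[|S|^{-1}S|S|^{-1}\bigr](U_S)^{-1}.$$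 -/

import Mathlib

open scoped InnerProductSpace LinearPMap

noncomputable section

namespace KreinBuckling

variable {E F G H : Type*}
  [NormedAddCommGroup E] [InnerProductSpace ℂ E]
  [NormedAddCommGroup F] [InnerProductSpace ℂ F]
  [NormedAddCommGroup G] [InnerProductSpace ℂ G]
  [NormedAddCommGroup H] [InnerProductSpace ℂ H]

/-! ### Generalities on unbounded operators -/

/-- The product `g f` of two unbounded operators on its natural domain
`{x ∈ dom f | f x ∈ dom g}`. -/
def mulOp (g : F →ₗ.[ℂ] G) (f : E →ₗ.[ℂ] F) : E →ₗ.[ℂ] G :=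
  g.comp (f.domRestrict ((g.domain.comap f.toFun).map f.domain.subtype)) (by
    rintro ⟨x, hx⟩
    obtain ⟨⟨y, hy, rfl⟩, -⟩ := hx
    exact hy)

theorem mem_mulOp_domain {g : F →ₗ.[ℂ] G} {f : E →ₗ.[ℂ] F} {x : E} :
    x ∈ (mulOp g f).domain ↔ ∃ hx : x ∈ f.domain, f ⟨x, hx⟩ ∈ g.domain := by
  constructor
  · rintro ⟨⟨y, hy, rfl⟩, -⟩
    exact ⟨y.2, hy⟩
  · rintro ⟨hx, hgx⟩
    exact ⟨⟨⟨x, hx⟩, hgx, rfl⟩, hx⟩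

theorem mulOp_apply {g : F →ₗ.[ℂ] G} {f : E →ₗ.[ℂ] F} (x : (mulOp g f).domain)
    (hx : (x : E) ∈ f.domain) (hgx : f ⟨x, hx⟩ ∈ g.domain) :
    mulOp g f x = g ⟨f ⟨x, hx⟩, hgx⟩ := rfl

/-- The kernel `{x ∈ dom A | A x = 0}` of an unbounded operator, as a subspace of the whole
space. -/
def kerOp (A : E →ₗ.[ℂ] F) : Submodule ℂ E :=
  (LinearMap.ker A.toFun).map A.domain.subtype

/-- `A ≥ c I`, in the sense that `(u, A u) ≥ c ‖u‖²` on `dom A`.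
It is only used for symmetric operators, for which `(u, A u)` is real. -/
def BoundedBelowBy (A : H →ₗ.[ℂ] H) (c : ℝ) : Prop :=
  ∀ u : A.domain, c * ‖(u : H)‖ ^ 2 ≤ (⟪(u : H), A u⟫_ℂ).re

/-- The operator `[I - P] A [I - P]` in `[I - P] H = Mᗮ`, where `P` is the orthogonal projection
onto (the closure of) `M`; its domain is `dom A ∩ Mᗮ`. -/
def compressionToOrthogonal [CompleteSpace H] (A : H →ₗ.[ℂ] H) (M : Submodule ℂ H) :
    Mᗮ →ₗ.[ℂ] Mᗮ where
  domain := A.domain.comap Mᗮ.subtype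
  toFun := (Mᗮ.orthogonalProjectionOnto : H →ₗ[ℂ] Mᗮ) ∘ₗ A.toFun ∘ₗ
    (Mᗮ.subtype.restrict (fun _ hx => hx) : A.domain.comap Mᗮ.subtype →ₗ[ℂ] A.domain)

/-! ### Square roots, the order between nonnegative operators, absolute value -/

section Complete

variable [CompleteSpace H]

/-- `R` is a nonnegative self-adjoint operator with `R² = A` (equality of unbounded operators,
including their domains). -/
structure IsNonnegSqrt (A R : H →ₗ.[ℂ] H) : Prop where
  isSelfAdjoint : IsSelfAdjoint R
  nonneg : BoundedBelowBy R 0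
  mul_self : mulOp R R = A

open Classical in
/-- The nonnegative self-adjoint square root `A^{1/2}`; it exists and is unique for each nonnegative
self-adjoint `A` (and the value is irrelevant for other `A`). -/
def sqrtOp (A : H →ₗ.[ℂ] H) : H →ₗ.[ℂ] H :=
  if h : ∃ R, IsNonnegSqrt A R then h.choose else ⊥

/-- The order `A ≤ B` between nonnegative self-adjoint operators:
`dom B^{1/2} ⊆ dom A^{1/2}` and `‖A^{1/2} u‖² ≤ ‖B^{1/2} u‖²` for `u ∈ dom B^{1/2}`. -/
def OpLE (A B : H →ₗ.[ℂ] H) : Prop :=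
  ∃ h : (sqrtOp B).domain ≤ (sqrtOp A).domain,
    ∀ u : (sqrtOp B).domain, ‖sqrtOp A ⟨u, h u.2⟩‖ ^ 2 ≤ ‖sqrtOp B u‖ ^ 2

/-- The absolute value `|S| = (S* S)^{1/2}`. -/
def absOp (S : H →ₗ.[ℂ] H) : H →ₗ.[ℂ] H :=
  sqrtOp (mulOp S† S)

/-! ### The Krein–von Neumann extension -/

/-- `A` is a nonnegative self-adjoint extension of `S`. -/
structure IsNonnegSelfAdjointExtension (S A : H →ₗ.[ℂ] H) : Prop where
  extends_op : S ≤ A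
  isSelfAdjoint : IsSelfAdjoint A
  nonneg : BoundedBelowBy A 0

/-- `K` is the smallest nonnegative self-adjoint extension of `S`. -/
structure IsKreinVonNeumannExtension (S K : H →ₗ.[ℂ] H) : Prop where
  isExtension : IsNonnegSelfAdjointExtension S K
  smallest : ∀ A : H →ₗ.[ℂ] H, IsNonnegSelfAdjointExtension S A → OpLE K A

/-- The Hilbert space `Ĥ = (ker S*)ᗮ`. -/
abbrev HatSpace (S : H →ₗ.[ℂ] H) : Submodule ℂ H := (kerOp S†)ᗮ

/-- For an extension `K` of `S` with `ker K = ker S*`, in particular for the Krein–von Neumann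
extension, the reduced operator `K̂ = [I - P] K [I - P]` in `Ĥ = (ker S*)ᗮ`, where `P` is the
orthogonal projection onto `ker S*`. -/
abbrev reducedOp (S K : H →ₗ.[ℂ] H) : HatSpace S →ₗ.[ℂ] HatSpace S :=
  compressionToOrthogonal K (kerOp S†)

end Complete

/-! ### Strictly positive operators, the space `W` and the abstract buckling operator -/

/-- `S` is densely defined, closed, symmetric, and `S ≥ ε I` with `ε > 0`. -/
structure IsStrictlyPositive (S : H →ₗ.[ℂ] H) (ε : ℝ) : Prop where
  dense : Dense (S.domain : Set H)
  closed : S.IsClosed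
  symmetric : S.IsFormalAdjoint S
  eps_pos : 0 < ε
  bound : BoundedBelowBy S ε

theorem IsStrictlyPositive.norm_le {S : H →ₗ.[ℂ] H} {ε : ℝ} (hS : IsStrictlyPositive S ε)
    (u : S.domain) : ε * ‖(u : H)‖ ≤ ‖S u‖ := by
  rcases (norm_nonneg (u : H)).eq_or_lt with h | h
  · rw [← h]; simp
  · have h1 := hS.bound u
    have h2 : (⟪(u : H), S u⟫_ℂ).re ≤ ‖(u : H)‖ * ‖S u‖ :=
      (Complex.re_le_norm _).trans (norm_inner_le_norm _ _)
    nlinarith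

/-- The space `W`: the vector space `dom S` with the scalar product `(u, v)_W = (S u, S v)`. -/
def FormSpace {S : H →ₗ.[ℂ] H} {ε : ℝ} (_ : IsStrictlyPositive S ε) : Type _ := S.domain

namespace FormSpace

variable {S : H →ₗ.[ℂ] H} {ε : ℝ} {hS : IsStrictlyPositive S ε}

instance : AddCommGroup (FormSpace hS) := inferInstanceAs (AddCommGroup S.domain)

instance : Module ℂ (FormSpace hS) := inferInstanceAs (Module ℂ S.domain)

variable (hS) in
/-- The embedding of `W` into `H`, as a linear map. -/
def toH : FormSpace hS →ₗ[ℂ] H := S.domain.subtype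

variable (hS) in
/-- The action of `S` on `W`, as a linear map `W → H`. -/
def applyS : FormSpace hS →ₗ[ℂ] H := S.toFun

/-- The scalar product `(u, v)_W = (S u, S v)`. -/
abbrev innerCore : InnerProductSpace.Core ℂ (FormSpace hS) where
  inner u v := ⟪applyS hS u, applyS hS v⟫_ℂ
  conj_inner_symm u v := inner_conj_symm _ _
  re_inner_nonneg u := inner_self_nonneg
  add_left u v w := by simp only [map_add, inner_add_left]
  smul_left u v c := by simp only [map_smul, inner_smul_left]
  definite u hu := by
    have h0 : S (show S.domain from u) = 0 := inner_self_eq_zero.1 hu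
    have h1 := hS.norm_le u
    rw [h0, norm_zero] at h1
    have h2 : ‖((show S.domain from u) : H)‖ ≤ 0 := by
      by_contra! h
      exact absurd h1 (not_le.2 (mul_pos hS.eps_pos h))
    exact Subtype.ext (norm_le_zero_iff.1 h2)

instance : NormedAddCommGroup (FormSpace hS) :=
  @InnerProductSpace.Core.toNormedAddCommGroup ℂ _ _ _ _ innerCore

instance : InnerProductSpace ℂ (FormSpace hS) := InnerProductSpace.ofCore innerCore.toCore

theorem inner_def (u v : FormSpace hS) : ⟪u, v⟫_ℂ = ⟪applyS hS u, applyS hS v⟫_ℂ := rfl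

theorem norm_def (u : FormSpace hS) : ‖u‖ = ‖applyS hS u‖ := by
  rw [@norm_eq_sqrt_re_inner ℂ, @norm_eq_sqrt_re_inner ℂ, inner_def]

/-- The continuous embedding `ι : W → H`. -/
def embed (hS : IsStrictlyPositive S ε) : FormSpace hS →L[ℂ] H :=
  (toH hS).mkContinuous ε⁻¹ fun u => by
    rw [norm_def, inv_mul_eq_div, le_div_iff₀ hS.eps_pos, mul_comm]
    exact hS.norm_le u

/-- The operator `S ι`, bounded from `W` to `H`. -/
def opL (hS : IsStrictlyPositive S ε) : FormSpace hS →L[ℂ] H :=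
  (applyS hS).mkContinuous 1 fun u => by rw [norm_def, one_mul]

instance [CompleteSpace H] : CompleteSpace (FormSpace hS) := by
  refine Metric.complete_of_cauchySeq_tendsto fun u hu => ?_
  obtain ⟨x, hx⟩ := cauchySeq_tendsto_of_complete ((embed hS).uniformContinuous.comp_cauchySeq hu)
  obtain ⟨y, hy⟩ := cauchySeq_tendsto_of_complete ((opL hS).uniformContinuous.comp_cauchySeq hu)
  have hxy : (x, y) ∈ (S.graph : Set (H × H)) :=
    IsClosed.mem_of_tendsto hS.closed (hx.prodMk_nhds hy)
      (Filter.Eventually.of_forall fun n => S.mem_graph (u n))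
  obtain ⟨v, -, hv⟩ := (LinearPMap.mem_graph_iff S).1 hxy
  refine ⟨v, tendsto_iff_norm_sub_tendsto_zero.2 ?_⟩
  have h : ∀ n, ‖u n - (show FormSpace hS from v)‖ = ‖opL hS (u n) - y‖ := fun n => by
    rw [norm_def, map_sub]
    exact congrArg (fun z => ‖S (u n) - z‖) hv
  simp only [h]
  exact tendsto_iff_norm_sub_tendsto_zero.1 hy

end FormSpace

/-- The abstract buckling problem operator `T` in `W`, that is, the bounded operator determined by
`(w₁, T w₂)_W = (w₁, S w₂)_H` (see `inner_bucklingOp`). -/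
def bucklingOp [CompleteSpace H] {S : H →ₗ.[ℂ] H} {ε : ℝ} (hS : IsStrictlyPositive S ε) :
    FormSpace hS →L[ℂ] FormSpace hS :=
  (FormSpace.embed hS).adjoint ∘L FormSpace.opL hS

theorem inner_bucklingOp [CompleteSpace H] {S : H →ₗ.[ℂ] H} {ε : ℝ}
    (hS : IsStrictlyPositive S ε) (w₁ w₂ : FormSpace hS) :
    ⟪w₁, bucklingOp hS w₂⟫_ℂ = ⟪FormSpace.embed hS w₁, FormSpace.opL hS w₂⟫_ℂ :=
  ContinuousLinearMap.adjoint_inner_right (FormSpace.embed hS) w₁ (FormSpace.opL hS w₂)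

end KreinBuckling

end

/-!
The Krein–von Neumann extension of a strictly positive `S` is explicit (`kreinOp`): its domain is
`dom S + ker S*`, and it sends `f + k` to `S f`. It is self-adjoint because `ran S` is closed,
hence equal to `(ker S*)ᗮ`, and its kernel is visibly `ker S*`.

Its minimality, `IsStrictlyPositive.isKreinVonNeumannExtension_kreinOp`, rests on a description of
the form of a nonnegative self-adjoint operator `A` in terms of `A` alone: `u ∈ dom A^{1/2}` and
`‖A^{1/2} u‖ ≤ c` if and only if `|(u, A g)|² ≤ c² (g, A g)` for all `g ∈ dom A`. This is proved
for any operator `T* T` with `T` closed and densely defined, in place of `(A^{1/2})²`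
(`exists_mem_graph_of_form_bound`, `norm_inner_sq_le_of_mem_graph`). If `A` extends `S`, the
condition for `kreinOp S` only involves the pairs `(f, S f)`, so that it follows from the one
for `A`. Uniqueness is the antisymmetry of the order (`eq_of_opLE_of_opLE`), by polarization.
The same description, applied to `S* S = |S|²`, gives `dom |S| = dom S` and `‖|S| u‖ = ‖S u‖`.

Square roots of unbounded operators are obtained from the bounded functional calculus of the
resolvent `R = (1 + A)⁻¹`: the graph of `A^{1/2}` is `{(R^{1/2} y, (1 - R)^{1/2} y)}`
(`exists_isNonnegSqrt`).

Finally, `(S v, S (T w)) = (v, S w)` for all `v ∈ dom S` says that `S (T w)` solves `S* x = S w`,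
so that it lies in `w + ker S*` and is mapped to `S w` by the extension; this is the formula for
the inverse of the reduced operator in terms of `T`. With `V = |S|⁻¹`, a unitary map from `H` onto
`W`, the polar factor is `U = Ŝ V`, and the formula in terms of `|S|⁻¹ S |S|⁻¹` is the first one
conjugated by `V`.
-/

namespace KreinBuckling

/-! ### Graphs of unbounded operators and their adjoints -/

section Graphs

variable {E F G H : Type*}
  [NormedAddCommGroup E] [InnerProductSpace ℂ E]
  [NormedAddCommGroup F] [InnerProductSpace ℂ F]
  [NormedAddCommGroup G] [InnerProductSpace ℂ G]
  [NormedAddCommGroup H] [InnerProductSpace ℂ H]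

theorem mem_mulOp_graph {g : F →ₗ.[ℂ] G} {f : E →ₗ.[ℂ] F} {x : E} {z : G} :
    (x, z) ∈ (mulOp g f).graph ↔ ∃ y, (x, y) ∈ f.graph ∧ (y, z) ∈ g.graph := by
  constructor
  · rw [LinearPMap.mem_graph_iff]
    rintro ⟨⟨x', hx'⟩, rfl, rfl⟩
    obtain ⟨hf, hg⟩ := mem_mulOp_domain.1 hx'
    exact ⟨f ⟨x', hf⟩, f.mem_graph ⟨x', hf⟩, g.mem_graph ⟨_, hg⟩⟩
  · rintro ⟨y, hxy, hyz⟩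
    obtain ⟨⟨x', hx'⟩, rfl, rfl⟩ := (LinearPMap.mem_graph_iff f).1 hxy
    obtain ⟨⟨y', hy'⟩, h1, rfl⟩ := (LinearPMap.mem_graph_iff g).1 hyz
    simp only at h1
    subst h1
    exact (mulOp g f).mem_graph ⟨x', mem_mulOp_domain.2 ⟨hx', hy'⟩⟩

theorem mem_graph_of_mem {f : E →ₗ.[ℂ] F} {x : E} (hx : x ∈ f.domain) :
    (x, f ⟨x, hx⟩) ∈ f.graph :=
  f.mem_graph ⟨x, hx⟩

theorem apply_eq_of_mem_graph {f : E →ₗ.[ℂ] F} {x : E} {y : F} (h : (x, y) ∈ f.graph)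
    (hx : x ∈ f.domain) : f ⟨x, hx⟩ = y :=
  ((LinearPMap.image_iff hx).2 h).symm

theorem swap_mem_inverse_graph {f : E →ₗ.[ℂ] F} (hf : LinearMap.ker f.toFun = ⊥) {x : E} {y : F} :
    (y, x) ∈ f.inverse.graph ↔ (x, y) ∈ f.graph := by
  rw [LinearPMap.inverse_graph hf, Submodule.mem_map]
  constructor
  · rintro ⟨⟨a, b⟩, hab, h⟩
    obtain ⟨rfl, rfl⟩ := Prod.mk.inj h
    exact hab
  · exact fun h => ⟨(x, y), h, rfl⟩

theorem mem_kerOp {A : E →ₗ.[ℂ] F} {x : E} : x ∈ kerOp A ↔ (x, 0) ∈ A.graph := by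
  rw [LinearPMap.mem_graph_iff]
  constructor
  · rintro ⟨y, hy, rfl⟩
    exact ⟨y, rfl, hy⟩
  · rintro ⟨y, rfl, hy⟩
    exact ⟨y, hy, rfl⟩

theorem mem_toPMap_top_graph (f : E →ₗ[ℂ] F) {x : E} {y : F} :
    (x, y) ∈ (f.toPMap ⊤).graph ↔ f x = y := by
  rw [LinearPMap.mem_graph_iff]
  constructor
  · rintro ⟨x', rfl, rfl⟩
    rfl
  · rintro rfl
    exact ⟨⟨x, trivial⟩, rfl, rfl⟩

theorem eq_of_mem_graph_iff {f g : E →ₗ.[ℂ] F} (h : ∀ x y, (x, y) ∈ f.graph ↔ (x, y) ∈ g.graph) :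
    f = g :=
  LinearPMap.eq_of_eq_graph (Submodule.ext fun p => h p.1 p.2)

/-- An everywhere defined operator has no proper extension. -/
theorem eq_toPMap_top_of_mem_graph {f : E →ₗ.[ℂ] F} {g : E →ₗ[ℂ] F}
    (h : ∀ x, (x, g x) ∈ f.graph) : f = g.toPMap ⊤ :=
  eq_of_mem_graph_iff fun x y => by
    rw [mem_toPMap_top_graph]
    refine ⟨fun hxy => f.mem_graph_snd_inj (h x) hxy rfl, ?_⟩
    rintro rfl
    exact h x

theorem ker_toFun_eq_bot {A : E →ₗ.[ℂ] F} (h : ∀ x, (x, 0) ∈ A.graph → x = 0) :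
    LinearMap.ker A.toFun = ⊥ := by
  refine LinearMap.ker_eq_bot'.2 fun x hx => Subtype.ext (h x ?_)
  exact (LinearPMap.mem_graph_iff A).2 ⟨x, rfl, hx⟩

theorem mem_adjoint_graph [CompleteSpace E] {T : E →ₗ.[ℂ] F} (hT : Dense (T.domain : Set E))
    {u : F} {v : E} :
    (u, v) ∈ T†.graph ↔ ∀ a b, (a, b) ∈ T.graph → ⟪b, u⟫_ℂ = ⟪a, v⟫_ℂ := by
  rw [LinearPMap.adjoint_graph_eq_graph_adjoint hT, Submodule.mem_adjoint_iff]
  simp only [sub_eq_zero]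

theorem inner_adjoint_graph [CompleteSpace E] {T : E →ₗ.[ℂ] F} (hT : Dense (T.domain : Set E))
    {u a : E} {v b : F} (h : (v, u) ∈ T†.graph) (h' : (a, b) ∈ T.graph) :
    ⟪b, v⟫_ℂ = ⟪a, u⟫_ℂ :=
  (mem_adjoint_graph hT).1 h a b h'

theorem inner_graph_of_isFormalAdjoint {A : H →ₗ.[ℂ] H} (hA : A.IsFormalAdjoint A) {a b c d : H}
    (h : (a, b) ∈ A.graph) (h' : (c, d) ∈ A.graph) : ⟪b, c⟫_ℂ = ⟪a, d⟫_ℂ := by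
  obtain ⟨x, rfl, rfl⟩ := (LinearPMap.mem_graph_iff A).1 h
  obtain ⟨y, rfl, rfl⟩ := (LinearPMap.mem_graph_iff A).1 h'
  exact hA x y

theorem norm_le_norm_add_of_inner_nonneg {x y : H} (h : 0 ≤ (⟪x, y⟫_ℂ).re) : ‖x‖ ≤ ‖x + y‖ := by
  have h1 := norm_add_sq (𝕜 := ℂ) x y
  have h2 : 0 ≤ RCLike.re ⟪x, y⟫_ℂ := h
  refine le_of_sq_le_sq ?_ (norm_nonneg _)
  nlinarith [sq_nonneg ‖y‖]

theorem inner_map_eq_of_norm_map_eq {V : Type*} [AddCommGroup V] [Module ℂ V] {f g : V →ₗ[ℂ] H}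
    (h : ∀ v, ‖f v‖ = ‖g v‖) (x y : V) : ⟪f x, f y⟫_ℂ = ⟪g x, g y⟫_ℂ := by
  simp only [inner_eq_sum_norm_sq_div_four, ← map_add, ← map_sub, ← map_smul, h]

theorem BoundedBelowBy.le_inner {A : H →ₗ.[ℂ] H} {c : ℝ} (hA : BoundedBelowBy A c) {a b : H}
    (h : (a, b) ∈ A.graph) : c * ‖a‖ ^ 2 ≤ (⟪a, b⟫_ℂ).re := by
  obtain ⟨x, rfl, rfl⟩ := (LinearPMap.mem_graph_iff A).1 h
  exact hA x

theorem isFormalAdjoint_of_isSelfAdjoint [CompleteSpace H] {A : H →ₗ.[ℂ] H}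
    (hA : IsSelfAdjoint A) : A.IsFormalAdjoint A := by
  have h := LinearPMap.adjoint_isFormalAdjoint hA.dense_domain
  rwa [LinearPMap.isSelfAdjoint_def.1 hA] at h

theorem mem_graph_iff_of_isSelfAdjoint [CompleteSpace H] {A : H →ₗ.[ℂ] H} (hA : IsSelfAdjoint A)
    {u v : H} : (u, v) ∈ A.graph ↔ ∀ a b, (a, b) ∈ A.graph → ⟪b, u⟫_ℂ = ⟪a, v⟫_ℂ := by
  rw [← mem_adjoint_graph hA.dense_domain, LinearPMap.isSelfAdjoint_def.1 hA]

/-- The orthogonal complement of the graph of `T` is the rotated graph of `T*`; hence each pair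
`(a, b)` is the sum of some `(v, T v)` and some `(-T* h, h)`. -/
theorem exists_graph_decomposition [CompleteSpace E] [CompleteSpace F] {T : E →ₗ.[ℂ] F}
    (hT : Dense (T.domain : Set E)) (hc : T.IsClosed) (a : E) (b : F) :
    ∃ v p h k, (v, p) ∈ T.graph ∧ (h, k) ∈ T†.graph ∧ a = v - k ∧ b = p + h := by
  let Γ : Submodule ℂ (WithLp 2 (E × F)) :=
    T.graph.comap (WithLp.linearEquiv 2 ℂ (E × F)).toLinearMap
  have hΓ : IsClosed (Γ : Set (WithLp 2 (E × F))) :=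
    IsClosed.preimage (WithLp.prod_continuous_ofLp 2 E F) hc
  have : CompleteSpace Γ := hΓ.completeSpace_coe
  obtain ⟨y, hy, z, hz, hyz⟩ := Γ.exists_add_mem_mem_orthogonal (WithLp.toLp 2 (a, b))
  refine ⟨y.fst, y.snd, z.snd, -z.fst, hy, ?_, ?_, ?_⟩
  · refine (mem_adjoint_graph hT).2 fun x w hxw => ?_
    have h := (Submodule.mem_orthogonal Γ z).1 hz (WithLp.toLp 2 (x, w)) hxw
    rw [WithLp.prod_inner_apply] at h
    rw [inner_neg_right]
    exact eq_neg_of_add_eq_zero_right h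
  · have := congrArg WithLp.fst hyz
    simpa using this
  · have := congrArg WithLp.snd hyz
    simpa using this

end Graphs

/-! ### Resolvents and square roots of nonnegative operators -/

section SquareRoots

variable {H : Type*} [NormedAddCommGroup H] [InnerProductSpace ℂ H] [CompleteSpace H]

/-- A self-adjoint operator `A + z` that is bounded away from zero is onto: its range is closed,
and an element orthogonal to the range is in the kernel. -/
theorem exists_mem_graph_add_smul_eq {A : H →ₗ.[ℂ] H} (hA : IsSelfAdjoint A) (z : ℝ) {c : ℝ}
    (hc : 0 < c) (h : ∀ x y, (x, y) ∈ A.graph → c * ‖x‖ ≤ ‖y + (z : ℂ) • x‖) (k : H) :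
    ∃ x y, (x, y) ∈ A.graph ∧ y + (z : ℂ) • x = k := by
  have hcl : IsClosed (A.graph : Set (H × H)) := hA.isClosed
  have : CompleteSpace A.graph := hcl.completeSpace_coe
  let φ : A.graph →L[ℂ] H :=
    (ContinuousLinearMap.snd ℂ H H + (z : ℂ) • ContinuousLinearMap.fst ℂ H H) ∘L A.graph.subtypeL
  have hφ : ∀ p : A.graph, φ p = p.1.2 + (z : ℂ) • p.1.1 := fun p => rfl
  have hanti : AntilipschitzWith (Real.toNNReal (c⁻¹ + (1 + |z| * c⁻¹))) φ := by
    refine φ.antilipschitz_of_bound fun p => ?_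
    rw [Real.coe_toNNReal _ (by positivity)]
    have h1 : ‖p.1.1‖ ≤ c⁻¹ * ‖φ p‖ := by
      rw [inv_mul_eq_div, le_div_iff₀ hc, mul_comm]
      exact h _ _ p.2
    have h2 : ‖p.1.2‖ ≤ ‖φ p‖ + |z| * ‖p.1.1‖ := by
      have : p.1.2 = φ p - (z : ℂ) • p.1.1 := by rw [hφ]; abel
      calc ‖p.1.2‖ = ‖φ p - (z : ℂ) • p.1.1‖ := by rw [← this]
        _ ≤ ‖φ p‖ + ‖(z : ℂ) • p.1.1‖ := norm_sub_le _ _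
        _ = _ := by rw [norm_smul, Complex.norm_real, Real.norm_eq_abs]
    have h3 : |z| * ‖p.1.1‖ ≤ |z| * (c⁻¹ * ‖φ p‖) := by gcongr
    have h4 : 0 ≤ c⁻¹ * ‖φ p‖ := by positivity
    have h5 : 0 ≤ |z| * (c⁻¹ * ‖φ p‖) := by positivity
    have h6 := norm_nonneg (φ p)
    change max ‖p.1.1‖ ‖p.1.2‖ ≤ _
    refine max_le ?_ ?_ <;> linarith
  have hran : IsClosed (LinearMap.range φ.toLinearMap : Set H) := by
    have := hanti.isClosed_range φ.uniformContinuous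
    rwa [← ContinuousLinearMap.coe_coe, ← LinearMap.coe_range] at this
  have hcs : CompleteSpace (LinearMap.range φ.toLinearMap) := hran.completeSpace_coe
  have htop : LinearMap.range φ.toLinearMap = ⊤ := by
    rw [← Submodule.orthogonal_eq_bot_iff, Submodule.eq_bot_iff]
    intro k hk
    have hmem : (k, (-(z : ℂ)) • k) ∈ A.graph := by
      refine (mem_graph_iff_of_isSelfAdjoint hA).2 fun x y hxy => ?_
      have h1 := (Submodule.mem_orthogonal _ k).1 hk _ ⟨⟨(x, y), hxy⟩, rfl⟩
      have h2 : ⟪y + (z : ℂ) • x, k⟫_ℂ = 0 := h1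
      rw [inner_add_left, inner_smul_left, Complex.conj_ofReal] at h2
      rw [inner_smul_right, neg_mul]
      exact eq_neg_of_add_eq_zero_left h2
    have h1 := h _ _ hmem
    rw [neg_smul, neg_add_cancel, norm_zero] at h1
    have h2 : ‖k‖ ≤ 0 := by
      by_contra! h'
      exact absurd h1 (not_le.2 (mul_pos hc h'))
    exact norm_le_zero_iff.1 h2
  obtain ⟨p, hp⟩ := (htop ▸ Submodule.mem_top : k ∈ LinearMap.range φ.toLinearMap)
  exact ⟨p.1.1, p.1.2, p.2, hp⟩

theorem exists_mem_graph_add_eq {A : H →ₗ.[ℂ] H} (hA : IsSelfAdjoint A)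
    (hnn : BoundedBelowBy A 0) (k : H) : ∃ x y, (x, y) ∈ A.graph ∧ x + y = k := by
  obtain ⟨x, y, hxy, h⟩ := exists_mem_graph_add_smul_eq hA 1 one_pos (fun x y hxy => by
    have h := hnn.le_inner hxy
    rw [zero_mul] at h
    rw [one_mul, Complex.ofReal_one, one_smul, add_comm]
    exact norm_le_norm_add_of_inner_nonneg h) k
  refine ⟨x, y, hxy, ?_⟩
  rwa [Complex.ofReal_one, one_smul, add_comm] at h

/-- The resolvent `R = (1 + A)⁻¹`: the graph of `A` is parametrized by `w ↦ (R w, w - R w)`. -/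
theorem exists_resolvent {A : H →ₗ.[ℂ] H} (hsymm : A.IsFormalAdjoint A)
    (hnn : BoundedBelowBy A 0) (hsurj : ∀ k, ∃ x y, (x, y) ∈ A.graph ∧ x + y = k) :
    ∃ R : H →L[ℂ] H, 0 ≤ R ∧ R ≤ 1 ∧ (∀ w, R w = 0 → w = 0) ∧
      ∀ x y, (x, y) ∈ A.graph ↔ ∃ w, R w = x ∧ w - R w = y := by
  let e₀ : A.domain →ₗ[ℂ] H := A.domain.subtype + A.toFun
  have hnn' : ∀ x : A.domain, 0 ≤ (⟪(x : H), A x⟫_ℂ).re := fun x => by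
    simpa using hnn x
  have hle : ∀ x : A.domain, ‖(x : H)‖ ≤ ‖e₀ x‖ := fun x =>
    norm_le_norm_add_of_inner_nonneg (hnn' x)
  have hinj : Function.Injective e₀ := by
    rw [← LinearMap.ker_eq_bot, LinearMap.ker_eq_bot']
    intro x hx
    have := hle x
    rw [hx, norm_zero] at this
    exact Subtype.ext (norm_le_zero_iff.1 this)
  have hsur : Function.Surjective e₀ := fun k => by
    obtain ⟨x, y, hxy, rfl⟩ := hsurj k
    obtain ⟨x', rfl, rfl⟩ := (LinearPMap.mem_graph_iff A).1 hxy
    exact ⟨x', rfl⟩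
  let e : A.domain ≃ₗ[ℂ] H := LinearEquiv.ofBijective e₀ ⟨hinj, hsur⟩
  have he : ∀ x : A.domain, e x = x + A x := fun x => rfl
  let R : H →L[ℂ] H := (A.domain.subtype ∘ₗ e.symm.toLinearMap).mkContinuous 1 fun w => by
    rw [one_mul]
    have := hle (e.symm w)
    rwa [show e₀ (e.symm w) = w from e.apply_symm_apply w] at this
  have hR : ∀ x : A.domain, R (e x) = x := fun x => by
    change ((e.symm (e x) : A.domain) : H) = x
    rw [e.symm_apply_apply]
  have hpos : R.IsPositive := by
    refine ContinuousLinearMap.isPositive_def.2 ⟨fun w w' => ?_, fun w => ?_⟩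
    · obtain ⟨x, rfl⟩ := e.surjective w
      obtain ⟨x', rfl⟩ := e.surjective w'
      change ⟪R (e x), e x'⟫_ℂ = ⟪e x, R (e x')⟫_ℂ
      rw [hR, hR, he, he, inner_add_left, inner_add_right, hsymm]
    · obtain ⟨x, rfl⟩ := e.surjective w
      rw [ContinuousLinearMap.reApplyInnerSelf_apply, hR, he, inner_add_right, map_add]
      exact add_nonneg inner_self_nonneg (hnn' x)
  refine ⟨R, (ContinuousLinearMap.nonneg_iff_isPositive R).2 hpos, ?_, fun w hw => ?_,
    fun x y => ⟨fun h => ?_, ?_⟩⟩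
  · rw [ContinuousLinearMap.le_def, ContinuousLinearMap.isPositive_def']
    refine ⟨(IsSelfAdjoint.one _).sub hpos.isSelfAdjoint, fun w => ?_⟩
    obtain ⟨x, rfl⟩ := e.surjective w
    rw [ContinuousLinearMap.reApplyInnerSelf_apply, sub_apply,
      one_apply_eq_self, hR, he, add_sub_cancel_left, inner_add_right, map_add]
    refine add_nonneg ?_ inner_self_nonneg
    rw [inner_re_symm]
    exact hnn' x
  · obtain ⟨x, rfl⟩ := e.surjective w
    rw [hR] at hw
    rw [show x = 0 from Subtype.ext hw, map_zero]
  · obtain ⟨x', rfl, rfl⟩ := (LinearPMap.mem_graph_iff A).1 h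
    exact ⟨e x', hR x', by rw [hR, he]; simp⟩
  · rintro ⟨w, rfl, rfl⟩
    obtain ⟨x, rfl⟩ := e.surjective w
    rw [hR, he, add_sub_cancel_left]
    exact A.mem_graph x

/-- For `0 ≤ R ≤ 1`, the commuting square roots `C` of `R` and `D` of `1 - R`. -/
theorem exists_commuting_sqrt {R : H →L[ℂ] H} (h0 : 0 ≤ R) (h1 : R ≤ 1) :
    ∃ C D : H →L[ℂ] H, IsSelfAdjoint C ∧ IsSelfAdjoint D ∧ C * C = R ∧ D * D = 1 - R ∧
      C * D = D * C ∧ 0 ≤ C * D := by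
  have hR : IsSelfAdjoint R := IsSelfAdjoint.of_nonneg h0
  have hs0 : ∀ x ∈ spectrum ℝ R, 0 ≤ x := fun x hx => spectrum_nonneg_of_nonneg h0 hx
  have hs1 : ∀ x ∈ spectrum ℝ R, x ≤ 1 := by
    have : R ≤ algebraMap ℝ (H →L[ℂ] H) 1 := by rwa [map_one]
    exact (le_algebraMap_iff_spectrum_le (a := R)).1 this
  have hcD : Continuous fun x : ℝ => √(1 - x) := by fun_prop
  refine ⟨cfc Real.sqrt R, cfc (fun x : ℝ => √(1 - x)) R, cfc_predicate _ _, cfc_predicate _ _,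
    ?_, ?_, cfc_commute_cfc _ _ _, ?_⟩
  · rw [← cfc_mul _ _ R (by fun_prop) (by fun_prop)]
    conv_rhs => rw [← cfc_id ℝ R]
    exact cfc_congr fun x hx => Real.mul_self_sqrt (hs0 x hx)
  · rw [← cfc_mul _ _ R hcD.continuousOn hcD.continuousOn]
    have : cfc (fun x : ℝ => 1 - x) R = 1 - R := by
      rw [cfc_sub (fun _ => (1 : ℝ)) (fun x => x) R, cfc_const_one ℝ R, cfc_id' ℝ R]
    rw [← this]
    exact cfc_congr fun x hx => Real.mul_self_sqrt (sub_nonneg.2 (hs1 x hx))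
  · rw [← cfc_mul _ _ R (by fun_prop) hcD.continuousOn]
    exact cfc_nonneg fun x _ => mul_nonneg (Real.sqrt_nonneg _) (Real.sqrt_nonneg _)

/-- With `R = (1 + A)⁻¹`, `C² = R` and `D² = 1 - R`, the square root of `A` is the operator
`C y ↦ D y`. -/
theorem exists_isNonnegSqrt {A : H →ₗ.[ℂ] H} (hsymm : A.IsFormalAdjoint A)
    (hnn : BoundedBelowBy A 0) (hsurj : ∀ k, ∃ x y, (x, y) ∈ A.graph ∧ x + y = k) :
    ∃ Q, IsNonnegSqrt A Q := by
  obtain ⟨R, hR0, hR1, hRinj, hRA⟩ := exists_resolvent hsymm hnn hsurj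
  obtain ⟨C, D, hC, hD, hCC, hDD, hCD, hCD0⟩ := exists_commuting_sqrt hR0 hR1
  have hCC' : ∀ w, C (C w) = R w := fun w => by rw [← hCC]; rfl
  have hDD' : ∀ w, D (D w) = w - R w := fun w => by
    rw [show D (D w) = (D * D) w from rfl, hDD]; rfl
  have hCD' : ∀ w, C (D w) = D (C w) := fun w => congrArg (fun X : H →L[ℂ] H => X w) hCD
  have hCinner : ∀ x y, ⟪C x, y⟫_ℂ = ⟪x, C y⟫_ℂ := hC.isSymmetric
  have hDinner : ∀ x y, ⟪D x, y⟫_ℂ = ⟪x, D y⟫_ℂ := hD.isSymmetric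
  have hCinj : ∀ w, C w = 0 → w = 0 := fun w hw => hRinj w (by rw [← hCC', hw, map_zero])
  let Γ : Submodule ℂ (H × H) := LinearMap.range (C.prod D).toLinearMap
  have hΓ : Γ.toLinearPMap.graph = Γ := by
    refine Submodule.toLinearPMap_graph_eq _ ?_
    rintro _ ⟨w, rfl⟩ (hw : C w = 0)
    change D w = 0
    rw [hCinj w hw, map_zero]
  have hmem : ∀ x y, (x, y) ∈ Γ.toLinearPMap.graph ↔ ∃ w, C w = x ∧ D w = y := fun x y => by
    rw [hΓ]
    exact ⟨fun ⟨w, hw⟩ => ⟨w, congrArg Prod.fst hw, congrArg Prod.snd hw⟩,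
      fun ⟨w, h1, h2⟩ => ⟨w, Prod.ext h1 h2⟩⟩
  have hdense : Dense (Γ.toLinearPMap.domain : Set H) := by
    rw [Submodule.dense_iff_topologicalClosure_eq_top,
      Submodule.topologicalClosure_eq_top_iff, Submodule.eq_bot_iff]
    intro k hk
    refine hCinj k (ext_inner_left ℂ fun w => ?_)
    rw [← hCinner, inner_zero_right]
    exact (Submodule.mem_orthogonal _ k).1 hk _
      (LinearPMap.mem_domain_of_mem_graph ((hmem _ _).2 ⟨w, rfl, rfl⟩))
  refine ⟨Γ.toLinearPMap, ?_, ?_, ?_⟩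
  · refine LinearPMap.isSelfAdjoint_def.2 (eq_of_mem_graph_iff fun u v => ?_)
    rw [mem_adjoint_graph hdense]
    constructor
    · intro h
      have hDC : D u = C v := ext_inner_left ℂ fun w => by
        rw [← hDinner, ← hCinner]
        exact h _ _ ((hmem _ _).2 ⟨w, rfl, rfl⟩)
      -- `C² + D² = 1` recovers the parameter of a pair `(C w, D w)` as `C (C w) + D (D w)`
      refine (hmem _ _).2 ⟨C u + D v, ?_, ?_⟩
      · rw [map_add, hCC', hCD', ← hDC, hDD']; abel
      · rw [map_add, ← hCD', hDC, hCC', hDD']; abel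
    · intro h a b hab
      obtain ⟨w, rfl, rfl⟩ := (hmem _ _).1 h
      obtain ⟨w', rfl, rfl⟩ := (hmem _ _).1 hab
      rw [hDinner, hCinner, hCD']
  · intro u
    obtain ⟨w, hw, hw'⟩ := (hmem _ _).1 (Γ.toLinearPMap.mem_graph u)
    rw [← hw, ← hw', zero_mul, hCinner]
    exact ((ContinuousLinearMap.nonneg_iff_isPositive _).1 hCD0).re_inner_nonneg_right w
  · refine eq_of_mem_graph_iff fun x z => ?_
    rw [mem_mulOp_graph, hRA]
    constructor
    · rintro ⟨y, hxy, hyz⟩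
      obtain ⟨w, rfl, rfl⟩ := (hmem _ _).1 hxy
      obtain ⟨w', h, rfl⟩ := (hmem _ _).1 hyz
      have hw : w = C (C w + D w') := by
        rw [map_add, hCC', hCD', h, hDD']; abel
      have hw' : w' = D (C w + D w') := by
        rw [map_add, ← hCD', ← h, hCC', hDD']; abel
      refine ⟨C w + D w', ?_, ?_⟩
      · rw [← hCC', ← hw]
      · rw [← hDD', ← hw']
    · rintro ⟨w, rfl, rfl⟩
      exact ⟨C (D w), (hmem _ _).2 ⟨C w, hCC' w, (hCD' w).symm⟩,
        (hmem _ _).2 ⟨D w, rfl, hDD' w⟩⟩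

theorem isNonnegSqrt_sqrtOp {A : H →ₗ.[ℂ] H} (h : ∃ Q, IsNonnegSqrt A Q) :
    IsNonnegSqrt A (sqrtOp A) := by
  rw [sqrtOp, dif_pos h]
  exact h.choose_spec

theorem isNonnegSqrt_sqrtOp_of_isSelfAdjoint {A : H →ₗ.[ℂ] H} (hA : IsSelfAdjoint A)
    (hnn : BoundedBelowBy A 0) : IsNonnegSqrt A (sqrtOp A) :=
  isNonnegSqrt_sqrtOp (exists_isNonnegSqrt (isFormalAdjoint_of_isSelfAdjoint hA) hnn
    (exists_mem_graph_add_eq hA hnn))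

end SquareRoots

/-! ### The operator `T* T`, its quadratic form, and the order between operators -/

section Forms

variable {H : Type*} [NormedAddCommGroup H] [InnerProductSpace ℂ H] [CompleteSpace H]

theorem mem_adjoint_mulOp_graph_add {T : H →ₗ.[ℂ] H} (hT : Dense (T.domain : Set H))
    (hc : T.IsClosed) (k : H) : ∃ x y, (x, y) ∈ (mulOp T† T).graph ∧ x + y = k := by
  obtain ⟨v, p, h, l, hv, hh, h1, h2⟩ := exists_graph_decomposition hT hc k 0
  obtain rfl : h = -p := eq_neg_of_add_eq_zero_right h2.symm
  refine ⟨v, -l, mem_mulOp_graph.2 ⟨p, hv, ?_⟩, by rw [h1, sub_eq_add_neg]⟩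
  simpa using neg_mem hh

theorem inner_of_mem_adjoint_mulOp_graph {T : H →ₗ.[ℂ] H} (hT : Dense (T.domain : Set H))
    {a b g z t : H} (hab : (a, b) ∈ T.graph) (hgt : (g, t) ∈ T.graph)
    (hgz : (g, z) ∈ (mulOp T† T).graph) : ⟪a, z⟫_ℂ = ⟪b, t⟫_ℂ := by
  obtain ⟨t', hgt', htz⟩ := mem_mulOp_graph.1 hgz
  obtain rfl : t = t' := T.mem_graph_snd_inj hgt hgt' rfl
  exact (inner_adjoint_graph hT htz hab).symm

theorem exists_isNonnegSqrt_adjoint_mulOp {T : H →ₗ.[ℂ] H} (hT : Dense (T.domain : Set H))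
    (hc : T.IsClosed) : ∃ Q, IsNonnegSqrt (mulOp T† T) Q := by
  refine exists_isNonnegSqrt (fun x y => ?_) (fun x => ?_) (mem_adjoint_mulOp_graph_add hT hc)
  · obtain ⟨t, hxt, -⟩ := mem_mulOp_graph.1 ((mulOp T† T).mem_graph x)
    obtain ⟨s, hys, -⟩ := mem_mulOp_graph.1 ((mulOp T† T).mem_graph y)
    rw [inner_of_mem_adjoint_mulOp_graph hT hxt hys ((mulOp T† T).mem_graph y),
      ← inner_conj_symm,
      inner_of_mem_adjoint_mulOp_graph hT hys hxt ((mulOp T† T).mem_graph x), inner_conj_symm]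
  · obtain ⟨t, hxt, -⟩ := mem_mulOp_graph.1 ((mulOp T† T).mem_graph x)
    rw [inner_of_mem_adjoint_mulOp_graph hT hxt hxt ((mulOp T† T).mem_graph x), zero_mul]
    exact inner_self_nonneg (𝕜 := ℂ)

/-- Riesz representation of a functional `ℓ` that is bounded relative to a linear map `f`. -/
theorem exists_inner_eq_of_norm_le {V : Type*} [AddCommGroup V] [Module ℂ V] (f : V →ₗ[ℂ] H)
    (ℓ : V →ₗ[ℂ] ℂ) {C : ℝ} (hC : 0 ≤ C) (h : ∀ v, ‖ℓ v‖ ≤ C * ‖f v‖) :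
    ∃ w : H, ‖w‖ ≤ C ∧ ∀ v, ℓ v = ⟪w, f v⟫_ℂ := by
  have hker : LinearMap.ker f ≤ LinearMap.ker ℓ := fun v hv => by
    have := h v
    rw [LinearMap.mem_ker.1 hv, norm_zero, mul_zero] at this
    exact norm_le_zero_iff.1 this
  let m : LinearMap.range f →ₗ[ℂ] ℂ :=
    (LinearMap.ker f).liftQ ℓ hker ∘ₗ f.quotKerEquivRange.symm.toLinearMap
  have hm : ∀ v, m ⟨f v, v, rfl⟩ = ℓ v := fun v => by
    have : f.quotKerEquivRange.symm ⟨f v, v, rfl⟩ = (LinearMap.ker f).mkQ v := by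
      rw [LinearEquiv.symm_apply_eq]
      exact Subtype.ext (f.quotKerEquivRange_apply_mk v).symm
    change (LinearMap.ker f).liftQ ℓ hker (f.quotKerEquivRange.symm ⟨f v, v, rfl⟩) = ℓ v
    rw [this]
    rfl
  let M : StrongDual ℂ (LinearMap.range f) := m.mkContinuous C (by
    rintro ⟨_, v, rfl⟩
    rw [hm]
    exact h v)
  obtain ⟨g, hg, hgn⟩ := exists_extension_norm_eq (LinearMap.range f) M
  refine ⟨(InnerProductSpace.toDual ℂ H).symm g, ?_, fun v => ?_⟩
  · rw [LinearIsometryEquiv.norm_map, hgn]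
    exact m.mkContinuous_norm_le hC _
  · rw [InnerProductSpace.toDual_symm_apply, ← hm]
    exact (hg ⟨f v, v, rfl⟩).symm

/-- The closed form of `T* T` is `‖T u‖²` with form domain `dom T`: if
`|(u, T* T g)|² ≤ c² (g, T* T g)` on `dom (T* T)`, then `u ∈ dom T` and `‖T u‖ ≤ c`. -/
theorem exists_mem_graph_of_form_bound {T : H →ₗ.[ℂ] H} (hT : Dense (T.domain : Set H))
    (hc : T.IsClosed) {u : H} {c : ℝ} (hc0 : 0 ≤ c)
    (h : ∀ g z, (g, z) ∈ (mulOp T† T).graph → ‖⟪u, z⟫_ℂ‖ ^ 2 ≤ c ^ 2 * (⟪g, z⟫_ℂ).re) :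
    ∃ y, (u, y) ∈ T.graph ∧ ‖y‖ ≤ c := by
  have hdom : ∀ x : (mulOp T† T).domain, (x : H) ∈ T.domain := fun x =>
    (mem_mulOp_domain.1 x.2).1
  let f : (mulOp T† T).domain →ₗ[ℂ] H :=
    T.toFun ∘ₗ ((mulOp T† T).domain.subtype.codRestrict T.domain hdom)
  have hf : ∀ x : (mulOp T† T).domain, ((x : H), f x) ∈ T.graph := fun x =>
    T.mem_graph ⟨x, hdom x⟩
  obtain ⟨w, hwc, hw⟩ := exists_inner_eq_of_norm_le f
    ((innerₛₗ ℂ u) ∘ₗ (mulOp T† T).toFun) hc0 fun x => by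
      refine le_of_sq_le_sq ?_ (by positivity)
      have h1 := h _ _ ((mulOp T† T).mem_graph x)
      rw [inner_of_mem_adjoint_mulOp_graph hT (hf x) (hf x) ((mulOp T† T).mem_graph x)] at h1
      have h2 : (⟪f x, f x⟫_ℂ).re = ‖f x‖ ^ 2 := (norm_sq_eq_re_inner (𝕜 := ℂ) (f x)).symm
      rw [h2] at h1
      rw [mul_pow]
      exact h1
  have hw' : ∀ g t z, (g, t) ∈ T.graph → (g, z) ∈ (mulOp T† T).graph → ⟪u, z⟫_ℂ = ⟪w, t⟫_ℂ := by
    intro g t z hgt hgz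
    obtain ⟨x, rfl, rfl⟩ := (LinearPMap.mem_graph_iff _).1 hgz
    rw [T.mem_graph_snd_inj hgt (hf x) rfl]
    exact hw x
  obtain ⟨v, p, q, k, hv, hq, hu, hwq⟩ := exists_graph_decomposition hT hc u w
  -- `k` is orthogonal to the range of `1 + T* T`, which is everything
  have hk : k = 0 := by
    obtain ⟨g, z, hgz, hgk⟩ := mem_adjoint_mulOp_graph_add hT hc k
    obtain ⟨t, hgt, -⟩ := mem_mulOp_graph.1 hgz
    have h1 := hw' g t z hgt hgz
    rw [hu, hwq, inner_sub_left, inner_add_left,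
      inner_of_mem_adjoint_mulOp_graph hT hv hgt hgz] at h1
    have h2 : ⟪q, t⟫_ℂ = ⟪k, g⟫_ℂ := by
      rw [← inner_conj_symm, inner_adjoint_graph hT hq hgt, inner_conj_symm]
    have h3 : ⟪k, g + z⟫_ℂ = 0 := by
      rw [inner_add_right, ← h2]
      linear_combination -h1
    rw [hgk] at h3
    exact inner_self_eq_zero.1 h3
  rw [hk] at hq hu
  rw [sub_zero] at hu
  refine ⟨p, hu ▸ hv, le_trans ?_ hwc⟩
  have h4 : ⟪p, q⟫_ℂ = 0 := by rw [inner_adjoint_graph hT hq hv, inner_zero_right]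
  rw [hwq]
  exact norm_le_norm_add_of_inner_nonneg (by rw [h4, Complex.zero_re])

theorem norm_inner_sq_le_of_mem_graph {T : H →ₗ.[ℂ] H} (hT : Dense (T.domain : Set H))
    {u p : H} (hu : (u, p) ∈ T.graph) {g z : H} (hgz : (g, z) ∈ (mulOp T† T).graph) :
    ‖⟪u, z⟫_ℂ‖ ^ 2 ≤ ‖p‖ ^ 2 * (⟪g, z⟫_ℂ).re := by
  obtain ⟨t, hgt, -⟩ := mem_mulOp_graph.1 hgz
  rw [inner_of_mem_adjoint_mulOp_graph hT hu hgt hgz,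
    inner_of_mem_adjoint_mulOp_graph hT hgt hgt hgz,
    show (⟪t, t⟫_ℂ).re = ‖t‖ ^ 2 from (norm_sq_eq_re_inner (𝕜 := ℂ) t).symm, ← mul_pow]
  exact pow_le_pow_left₀ (norm_nonneg _) (norm_inner_le_norm _ _) 2

/-- `T* T` determines `dom T` and `‖T u‖`. -/
theorem exists_mem_graph_of_adjoint_mulOp_eq {T T' : H →ₗ.[ℂ] H}
    (hT : Dense (T.domain : Set H)) (hT' : Dense (T'.domain : Set H)) (hc : T'.IsClosed)
    (heq : mulOp T† T = mulOp T'† T') {u p : H} (hu : (u, p) ∈ T.graph) :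
    ∃ q, (u, q) ∈ T'.graph ∧ ‖q‖ ≤ ‖p‖ :=
  exists_mem_graph_of_form_bound hT' hc (norm_nonneg p) fun _ _ hgz =>
    norm_inner_sq_le_of_mem_graph hT hu (heq ▸ hgz)

theorem IsNonnegSqrt.adjoint_mulOp {A Q : H →ₗ.[ℂ] H} (h : IsNonnegSqrt A Q) :
    mulOp Q† Q = A := by
  rw [LinearPMap.isSelfAdjoint_def.1 h.isSelfAdjoint, h.mul_self]

/-- The order between nonnegative self-adjoint operators is antisymmetric. -/
theorem eq_of_opLE_of_opLE {A B : H →ₗ.[ℂ] H} (hA : IsNonnegSqrt A (sqrtOp A))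
    (hB : IsNonnegSqrt B (sqrtOp B)) (hAB : OpLE A B) (hBA : OpLE B A) : A = B := by
  -- by symmetry, one inclusion of graphs suffices
  have key : ∀ {A B : H →ₗ.[ℂ] H}, IsNonnegSqrt A (sqrtOp A) → IsNonnegSqrt B (sqrtOp B) →
      OpLE A B → OpLE B A → ∀ x y, (x, y) ∈ A.graph → (x, y) ∈ B.graph := by
    rintro A B hA hB ⟨h1, h1'⟩ ⟨h2, h2'⟩ x y hxy
    let f : (sqrtOp B).domain →ₗ[ℂ] H := (sqrtOp A).toFun ∘ₗ Submodule.inclusion h1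
    have hfg : ∀ u, ‖f u‖ = ‖(sqrtOp B).toFun u‖ := fun u =>
      le_antisymm (le_of_sq_le_sq (h1' u) (norm_nonneg _))
        (le_of_sq_le_sq (h2' ⟨u, h1 u.2⟩) (norm_nonneg _))
    obtain ⟨t, hxt, -⟩ := mem_mulOp_graph.1 (hA.adjoint_mulOp.symm ▸ hxy)
    have hx : x ∈ (sqrtOp B).domain := h2 (LinearPMap.mem_domain_of_mem_graph hxt)
    rw [← hB.mul_self]
    refine mem_mulOp_graph.2 ⟨_, mem_graph_of_mem hx, ?_⟩
    refine (mem_graph_iff_of_isSelfAdjoint hB.isSelfAdjoint).2 fun a b hab => ?_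
    obtain ⟨a, rfl, rfl⟩ := (LinearPMap.mem_graph_iff _).1 hab
    have h3 := inner_map_eq_of_norm_map_eq hfg a ⟨x, hx⟩
    refine h3.symm.trans ?_
    exact (inner_of_mem_adjoint_mulOp_graph hA.isSelfAdjoint.dense_domain
      (mem_graph_of_mem (h1 a.2)) (mem_graph_of_mem (h1 hx))
      (hA.adjoint_mulOp.symm ▸ hxy)).symm
  exact eq_of_mem_graph_iff fun x y => ⟨key hA hB hAB hBA x y, key hB hA hBA hAB x y⟩

end Forms

/-! ### Strictly positive operators -/

section StrictlyPositive

variable {H : Type*} [NormedAddCommGroup H] [InnerProductSpace ℂ H] {S : H →ₗ.[ℂ] H} {ε : ℝ}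

theorem IsStrictlyPositive.norm_le_of_mem_graph (hS : IsStrictlyPositive S ε) {u v : H}
    (h : (u, v) ∈ S.graph) : ε * ‖u‖ ≤ ‖v‖ := by
  obtain ⟨x, rfl, rfl⟩ := (LinearPMap.mem_graph_iff S).1 h
  exact hS.norm_le x

theorem IsStrictlyPositive.eq_zero_of_mem_graph (hS : IsStrictlyPositive S ε) {u : H}
    (h : (u, 0) ∈ S.graph) : u = 0 := by
  have h1 := hS.norm_le_of_mem_graph h
  rw [norm_zero] at h1
  refine norm_le_zero_iff.1 (le_of_not_gt fun h' => ?_)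
  exact absurd h1 (not_le.2 (mul_pos hS.eps_pos h'))

theorem FormSpace.mem_graph {hS : IsStrictlyPositive S ε} (w : FormSpace hS) :
    (embed hS w, opL hS w) ∈ S.graph :=
  S.mem_graph w

end StrictlyPositive

/-! ### The Krein–von Neumann extension -/

section Krein

variable {H : Type*} [NormedAddCommGroup H] [InnerProductSpace ℂ H] [CompleteSpace H]
  {S : H →ₗ.[ℂ] H} {ε : ℝ}

theorem IsStrictlyPositive.graph_le_adjoint_graph (hS : IsStrictlyPositive S ε) :
    S.graph ≤ S†.graph :=
  LinearPMap.le_graph_of_le (hS.symmetric.le_adjoint hS.dense)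

theorem IsStrictlyPositive.inner_eq_zero (hS : IsStrictlyPositive S ε) {u v k : H}
    (h : (u, v) ∈ S.graph) (hk : k ∈ kerOp S†) : ⟪v, k⟫_ℂ = 0 := by
  rw [inner_adjoint_graph hS.dense (mem_kerOp.1 hk) h, inner_zero_right]

theorem IsStrictlyPositive.mem_kerOp_iff (hS : IsStrictlyPositive S ε) {k : H} :
    k ∈ kerOp S† ↔ ∀ u v, (u, v) ∈ S.graph → ⟪v, k⟫_ℂ = 0 := by
  rw [mem_kerOp, mem_adjoint_graph hS.dense]
  simp only [inner_zero_right]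

/-- Since `S` is bounded below, its range is closed, hence equal to `(ker S*)ᗮ`. -/
theorem IsStrictlyPositive.mem_hatSpace_iff (hS : IsStrictlyPositive S ε) {y : H} :
    y ∈ HatSpace S ↔ ∃ x, (x, y) ∈ S.graph := by
  have hiso : Isometry (FormSpace.opL hS) :=
    AddMonoidHomClass.isometry_of_norm _ fun w => (FormSpace.norm_def w).symm
  have hcl : IsClosed (LinearMap.range (FormSpace.opL hS).toLinearMap : Set H) := by
    have := hiso.isClosedEmbedding.isClosed_range
    rwa [← ContinuousLinearMap.coe_coe, ← LinearMap.coe_range] at this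
  have : CompleteSpace (LinearMap.range (FormSpace.opL hS).toLinearMap) :=
    hcl.completeSpace_coe
  have hmem : ∀ y, y ∈ LinearMap.range (FormSpace.opL hS).toLinearMap ↔
      ∃ x, (x, y) ∈ S.graph := fun y =>
    ⟨fun ⟨w, hw⟩ => ⟨_, (LinearPMap.mem_graph_iff S).2 ⟨w, rfl, hw⟩⟩, fun ⟨x, hx⟩ => by
      obtain ⟨w, -, hw⟩ := (LinearPMap.mem_graph_iff S).1 hx
      exact ⟨w, hw⟩⟩
  have hker : kerOp S† = (LinearMap.range (FormSpace.opL hS).toLinearMap)ᗮ := by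
    ext k
    rw [hS.mem_kerOp_iff, Submodule.mem_orthogonal]
    exact ⟨fun h y hy => ((hmem y).1 hy).elim fun x hx => h x y hx,
      fun h u v huv => h v ((hmem v).2 ⟨u, huv⟩)⟩
  rw [← hmem, HatSpace, hker, Submodule.orthogonal_orthogonal]

/-- The graph of the Krein–von Neumann extension: `S` on `dom S`, extended by zero to
`ker S*`. -/
noncomputable def kreinGraph (S : H →ₗ.[ℂ] H) : Submodule ℂ (H × H) :=
  S.graph ⊔ (kerOp S†).prod ⊥

theorem mem_kreinGraph {x y : H} :
    (x, y) ∈ kreinGraph S ↔ ∃ f k, (f, y) ∈ S.graph ∧ k ∈ kerOp S† ∧ f + k = x := by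
  rw [kreinGraph, Submodule.mem_sup]
  constructor
  · rintro ⟨⟨f, y'⟩, hf, ⟨k, z⟩, ⟨hk, hz⟩, h⟩
    obtain rfl : z = 0 := hz
    obtain ⟨rfl, rfl⟩ := Prod.mk.inj h
    exact ⟨f, k, by simpa using hf, hk, rfl⟩
  · rintro ⟨f, k, hf, hk, rfl⟩
    exact ⟨(f, y), hf, (k, 0), ⟨hk, rfl⟩, by simp⟩

/-- The Krein–von Neumann extension of a strictly positive operator: its domain is
`dom S + ker S*`, and it maps `f + k` to `S f`. -/
noncomputable def kreinOp (S : H →ₗ.[ℂ] H) : H →ₗ.[ℂ] H :=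
  (kreinGraph S).toLinearPMap

theorem IsStrictlyPositive.mem_kreinOp_graph (hS : IsStrictlyPositive S ε) {x y : H} :
    (x, y) ∈ (kreinOp S).graph ↔ ∃ f k, (f, y) ∈ S.graph ∧ k ∈ kerOp S† ∧ f + k = x := by
  rw [← mem_kreinGraph, kreinOp, Submodule.toLinearPMap_graph_eq]
  rintro ⟨x, y⟩ hxy (rfl : x = 0)
  obtain ⟨f, k, hf, hk, hfk⟩ := mem_kreinGraph.1 hxy
  -- `f = -k` lies in `ker S*`, and `S f = S* f`
  rw [eq_neg_of_add_eq_zero_left hfk] at hf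
  exact S†.mem_graph_snd_inj (hS.graph_le_adjoint_graph hf) (mem_kerOp.1 (neg_mem hk)) rfl

theorem IsStrictlyPositive.le_kreinOp (hS : IsStrictlyPositive S ε) : S ≤ kreinOp S :=
  LinearPMap.le_of_le_graph fun p hp =>
    hS.mem_kreinOp_graph.2 ⟨p.1, 0, hp, zero_mem _, add_zero _⟩

theorem IsStrictlyPositive.isSelfAdjoint_kreinOp (hS : IsStrictlyPositive S ε) :
    IsSelfAdjoint (kreinOp S) := by
  have hd : Dense ((kreinOp S).domain : Set H) := hS.dense.mono hS.le_kreinOp.1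
  refine LinearPMap.isSelfAdjoint_def.2 (eq_of_mem_graph_iff fun x y => ?_)
  rw [mem_adjoint_graph hd, hS.mem_kreinOp_graph]
  constructor
  · intro h
    have hy : y ∈ HatSpace S := (Submodule.mem_orthogonal _ _).2 fun k hk => by
      rw [← h k 0 (hS.mem_kreinOp_graph.2 ⟨0, k, zero_mem _, hk, zero_add k⟩), inner_zero_left]
    obtain ⟨w, hw⟩ := hS.mem_hatSpace_iff.1 hy
    refine ⟨w, x - w, hw, hS.mem_kerOp_iff.2 fun u v huv => ?_, add_sub_cancel _ _⟩
    rw [inner_sub_right, h u v (hS.mem_kreinOp_graph.2 ⟨u, 0, huv, zero_mem _, add_zero u⟩),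
      inner_graph_of_isFormalAdjoint hS.symmetric huv hw, sub_self]
  · rintro ⟨f, k, hf, hk, rfl⟩ a b hab
    obtain ⟨g, l, hg, hl, rfl⟩ := hS.mem_kreinOp_graph.1 hab
    rw [inner_add_right, inner_add_left, hS.inner_eq_zero hg hk, ← inner_conj_symm l y,
      hS.inner_eq_zero hf hl, inner_graph_of_isFormalAdjoint hS.symmetric hg hf, map_zero]

theorem IsStrictlyPositive.isNonnegSelfAdjointExtension_kreinOp (hS : IsStrictlyPositive S ε) :
    IsNonnegSelfAdjointExtension S (kreinOp S) where
  extends_op := hS.le_kreinOp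
  isSelfAdjoint := hS.isSelfAdjoint_kreinOp
  nonneg u := by
    obtain ⟨f, k, hf, hk, hfk⟩ := hS.mem_kreinOp_graph.1 ((kreinOp S).mem_graph u)
    rw [zero_mul, ← hfk, inner_add_left, ← inner_conj_symm k, hS.inner_eq_zero hf hk, map_zero,
      add_zero]
    exact le_trans (mul_nonneg hS.eps_pos.le (sq_nonneg _)) (hS.bound.le_inner hf)

/-- Minimality: for `g = f + k` in the domain of the Krein–von Neumann extension `K` one has
`K g = S f = A f` and `(g, K g) = (f, A f)`, so that each bound `|(u, A f)|² ≤ c² (f, A f)`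
that holds on `dom A` passes to `K`. -/
theorem IsStrictlyPositive.isKreinVonNeumannExtension_kreinOp (hS : IsStrictlyPositive S ε) :
    IsKreinVonNeumannExtension S (kreinOp S) where
  isExtension := hS.isNonnegSelfAdjointExtension_kreinOp
  smallest A hA := by
    have hK := hS.isNonnegSelfAdjointExtension_kreinOp
    have hQ := isNonnegSqrt_sqrtOp_of_isSelfAdjoint hK.isSelfAdjoint hK.nonneg
    have hR := isNonnegSqrt_sqrtOp_of_isSelfAdjoint hA.isSelfAdjoint hA.nonneg
    have key : ∀ u p, (u, p) ∈ (sqrtOp A).graph →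
        ∃ q, (u, q) ∈ (sqrtOp (kreinOp S)).graph ∧ ‖q‖ ≤ ‖p‖ := fun u p hu => by
      refine exists_mem_graph_of_form_bound hQ.isSelfAdjoint.dense_domain
        hQ.isSelfAdjoint.isClosed (norm_nonneg p) fun g z hgz => ?_
      rw [hQ.adjoint_mulOp] at hgz
      obtain ⟨f, k, hf, hk, rfl⟩ := hS.mem_kreinOp_graph.1 hgz
      rw [inner_add_left, ← inner_conj_symm k, hS.inner_eq_zero hf hk, map_zero, add_zero]
      refine norm_inner_sq_le_of_mem_graph hR.isSelfAdjoint.dense_domain hu ?_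
      rw [hR.adjoint_mulOp]
      exact LinearPMap.le_graph_of_le hA.extends_op hf
    have hle : (sqrtOp A).domain ≤ (sqrtOp (kreinOp S)).domain := fun u hu =>
      (key u _ (mem_graph_of_mem hu)).elim fun q hq => LinearPMap.mem_domain_of_mem_graph hq.1
    refine ⟨hle, fun u => ?_⟩
    obtain ⟨q, hq, hqp⟩ := key u _ ((sqrtOp A).mem_graph u)
    rw [apply_eq_of_mem_graph hq]
    exact pow_le_pow_left₀ (norm_nonneg _) hqp 2

theorem IsStrictlyPositive.eq_kreinOp (hS : IsStrictlyPositive S ε) {K : H →ₗ.[ℂ] H}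
    (hK : IsKreinVonNeumannExtension S K) : K = kreinOp S := by
  have h := hS.isKreinVonNeumannExtension_kreinOp
  exact eq_of_opLE_of_opLE
    (isNonnegSqrt_sqrtOp_of_isSelfAdjoint hK.isExtension.isSelfAdjoint hK.isExtension.nonneg)
    (isNonnegSqrt_sqrtOp_of_isSelfAdjoint h.isExtension.isSelfAdjoint h.isExtension.nonneg)
    (hK.smallest _ h.isExtension) (h.smallest _ hK.isExtension)

theorem IsStrictlyPositive.kerOp_kreinOp (hS : IsStrictlyPositive S ε) :
    kerOp (kreinOp S) = kerOp S† := by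
  ext k
  rw [mem_kerOp, hS.mem_kreinOp_graph]
  constructor
  · rintro ⟨f, k, hf, hk, rfl⟩
    rwa [hS.eq_zero_of_mem_graph hf, zero_add]
  · exact fun hk => ⟨0, k, zero_mem _, hk, zero_add k⟩

theorem IsStrictlyPositive.reducedOp_apply (hS : IsStrictlyPositive S ε)
    (x : (reducedOp S (kreinOp S)).domain) (hx : ((x : HatSpace S) : H) ∈ (kreinOp S).domain) :
    (reducedOp S (kreinOp S) x : H) = kreinOp S ⟨_, hx⟩ := by
  obtain ⟨f, k, hf, -, -⟩ := hS.mem_kreinOp_graph.1 (mem_graph_of_mem hx)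
  exact Submodule.starProjection_eq_self_iff.2 (hS.mem_hatSpace_iff.2 ⟨f, hf⟩)

theorem IsStrictlyPositive.mem_reducedOp_graph (hS : IsStrictlyPositive S ε)
    {x y : HatSpace S} :
    (x, y) ∈ (reducedOp S (kreinOp S)).graph ↔ ((x : H), (y : H)) ∈ (kreinOp S).graph := by
  constructor
  · intro h
    obtain ⟨x, rfl, rfl⟩ := (LinearPMap.mem_graph_iff _).1 h
    rw [hS.reducedOp_apply x x.2]
    exact mem_graph_of_mem _
  · intro h
    have hx : (x : H) ∈ (kreinOp S).domain := LinearPMap.mem_domain_of_mem_graph h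
    refine (LinearPMap.mem_graph_iff _).2 ⟨⟨x, hx⟩, rfl, Subtype.ext ?_⟩
    rw [hS.reducedOp_apply ⟨x, hx⟩ hx]
    exact apply_eq_of_mem_graph h hx

theorem IsStrictlyPositive.ker_reducedOp (hS : IsStrictlyPositive S ε) :
    LinearMap.ker (reducedOp S (kreinOp S)).toFun = ⊥ := by
  refine ker_toFun_eq_bot fun x hx => Subtype.ext ?_
  have hk : (x : H) ∈ kerOp S† := by
    rw [← hS.kerOp_kreinOp, mem_kerOp]
    exact hS.mem_reducedOp_graph.1 hx
  exact inner_self_eq_zero.1 ((Submodule.mem_orthogonal _ _).1 x.2 x hk)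

end Krein

/-! ### The abstract buckling operator -/

section Buckling

variable {H : Type*} [NormedAddCommGroup H] [InnerProductSpace ℂ H] [CompleteSpace H]
  {S : H →ₗ.[ℂ] H} {ε : ℝ}

theorem IsStrictlyPositive.isPositive_bucklingOp (hS : IsStrictlyPositive S ε) :
    (bucklingOp hS).IsPositive := by
  refine ContinuousLinearMap.isPositive_def.2 ⟨fun v w => ?_, fun w => ?_⟩
  · change ⟪bucklingOp hS v, w⟫_ℂ = ⟪v, bucklingOp hS w⟫_ℂ
    rw [← inner_conj_symm, inner_bucklingOp, inner_bucklingOp, inner_conj_symm]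
    exact inner_graph_of_isFormalAdjoint hS.symmetric v.mem_graph w.mem_graph
  · rw [ContinuousLinearMap.reApplyInnerSelf_apply, inner_re_symm, inner_bucklingOp]
    exact le_trans (mul_nonneg hS.eps_pos.le (sq_nonneg _)) (hS.bound.le_inner w.mem_graph)

/-- The map `w ↦ S w`, unitary from `W` onto `(ker S*)ᗮ = ran S`. -/
noncomputable def IsStrictlyPositive.hatEquiv (hS : IsStrictlyPositive S ε) :
    FormSpace hS ≃ₗᵢ[ℂ] HatSpace S :=
  LinearIsometryEquiv.ofSurjective
    { toLinearMap := (FormSpace.opL hS).toLinearMap.codRestrict (HatSpace S) fun w =>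
        hS.mem_hatSpace_iff.2 ⟨_, w.mem_graph⟩
      norm_map' := fun w => (FormSpace.norm_def w).symm } (by
    rintro ⟨y, hy⟩
    obtain ⟨x, hx⟩ := hS.mem_hatSpace_iff.1 hy
    obtain ⟨w, -, hw⟩ := (LinearPMap.mem_graph_iff S).1 hx
    exact ⟨w, Subtype.ext hw⟩)

theorem IsStrictlyPositive.coe_hatEquiv (hS : IsStrictlyPositive S ε) (w : FormSpace hS) :
    (hS.hatEquiv w : H) = FormSpace.opL hS w :=
  rfl

/-- The element `S (T w)` solves `S* x = S w`, so that it differs from `w` by an element of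
`ker S*`; this makes `T` the inverse of the reduced operator, up to the unitary `w ↦ S w`. -/
theorem IsStrictlyPositive.mem_reducedOp_graph_hatEquiv (hS : IsStrictlyPositive S ε)
    (w : FormSpace hS) :
    (hS.hatEquiv (bucklingOp hS w), hS.hatEquiv w) ∈ (reducedOp S (kreinOp S)).graph := by
  rw [hS.mem_reducedOp_graph, hS.mem_kreinOp_graph, hS.coe_hatEquiv, hS.coe_hatEquiv]
  refine ⟨FormSpace.embed hS w, FormSpace.opL hS (bucklingOp hS w) - FormSpace.embed hS w,
    w.mem_graph, hS.mem_kerOp_iff.2 fun u v huv => ?_, add_sub_cancel _ _⟩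
  obtain ⟨u, rfl, rfl⟩ := (LinearPMap.mem_graph_iff S).1 huv
  have h : ⟪S u, FormSpace.opL hS (bucklingOp hS w)⟫_ℂ = ⟪(u : H), FormSpace.opL hS w⟫_ℂ :=
    inner_bucklingOp hS u w
  rw [inner_sub_right, h,
    inner_graph_of_isFormalAdjoint hS.symmetric (S.mem_graph u) w.mem_graph, sub_self]

theorem IsStrictlyPositive.inverse_reducedOp (hS : IsStrictlyPositive S ε) :
    (reducedOp S (kreinOp S)).inverse =
      (hS.hatEquiv.toLinearEquiv.toLinearMap ∘ₗ (bucklingOp hS).toLinearMap ∘ₗ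
        hS.hatEquiv.symm.toLinearEquiv.toLinearMap).toPMap ⊤ := by
  refine eq_toPMap_top_of_mem_graph fun y => (swap_mem_inverse_graph hS.ker_reducedOp).2 ?_
  have h := hS.mem_reducedOp_graph_hatEquiv (hS.hatEquiv.symm y)
  rwa [hS.hatEquiv.apply_symm_apply] at h

end Buckling

/-! ### The absolute value and the polar decomposition -/

section AbsoluteValue

variable {H : Type*} [NormedAddCommGroup H] [InnerProductSpace ℂ H] [CompleteSpace H]
  {S : H →ₗ.[ℂ] H} {ε : ℝ}

theorem IsStrictlyPositive.isNonnegSqrt_absOp (hS : IsStrictlyPositive S ε) :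
    IsNonnegSqrt (mulOp S† S) (absOp S) :=
  isNonnegSqrt_sqrtOp (exists_isNonnegSqrt_adjoint_mulOp hS.dense hS.closed)

theorem IsStrictlyPositive.mem_absOp_graph_of_mem (hS : IsStrictlyPositive S ε) {u p : H}
    (hu : (u, p) ∈ S.graph) : ∃ q, (u, q) ∈ (absOp S).graph ∧ ‖q‖ = ‖p‖ := by
  have h := hS.isNonnegSqrt_absOp
  obtain ⟨q, hq, hqp⟩ := exists_mem_graph_of_adjoint_mulOp_eq hS.dense
    h.isSelfAdjoint.dense_domain h.isSelfAdjoint.isClosed h.adjoint_mulOp.symm hu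
  obtain ⟨p', hp', hpq⟩ := exists_mem_graph_of_adjoint_mulOp_eq
    h.isSelfAdjoint.dense_domain hS.dense hS.closed h.adjoint_mulOp hq
  obtain rfl : p = p' := S.mem_graph_snd_inj hu hp' rfl
  exact ⟨q, hq, le_antisymm hqp hpq⟩

theorem IsStrictlyPositive.mem_graph_of_mem_absOp_graph (hS : IsStrictlyPositive S ε) {u q : H}
    (hu : (u, q) ∈ (absOp S).graph) : ∃ p, (u, p) ∈ S.graph ∧ ‖p‖ = ‖q‖ := by
  have h := hS.isNonnegSqrt_absOp
  obtain ⟨p, hp, -⟩ := exists_mem_graph_of_adjoint_mulOp_eq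
    h.isSelfAdjoint.dense_domain hS.dense hS.closed h.adjoint_mulOp hu
  obtain ⟨q', hq', hn⟩ := hS.mem_absOp_graph_of_mem hp
  obtain rfl : q = q' := (absOp S).mem_graph_snd_inj hu hq' rfl
  exact ⟨p, hp, hn.symm⟩

theorem IsStrictlyPositive.norm_le_of_mem_absOp_graph (hS : IsStrictlyPositive S ε) {u q : H}
    (hu : (u, q) ∈ (absOp S).graph) : ε * ‖u‖ ≤ ‖q‖ := by
  obtain ⟨p, hp, hpq⟩ := hS.mem_graph_of_mem_absOp_graph hu
  exact hpq ▸ hS.norm_le_of_mem_graph hp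

theorem IsStrictlyPositive.exists_mem_absOp_graph (hS : IsStrictlyPositive S ε) (k : H) :
    ∃ x, (x, k) ∈ (absOp S).graph := by
  obtain ⟨x, y, hxy, h⟩ := exists_mem_graph_add_smul_eq hS.isNonnegSqrt_absOp.isSelfAdjoint 0
    hS.eps_pos (fun x y hxy => by
      simpa using hS.norm_le_of_mem_absOp_graph hxy) k
  have : y = k := by simpa using h
  exact ⟨x, this ▸ hxy⟩

/-- A nonnegative self-adjoint `M` with `‖M u‖ ≥ ε ‖u‖` satisfies `M ≥ ε`: expand
`(u - ε w, M (u - ε w)) ≥ 0` for the solution `w` of `M w = u`. -/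
theorem IsStrictlyPositive.boundedBelowBy_absOp (hS : IsStrictlyPositive S ε) :
    BoundedBelowBy (absOp S) ε := by
  intro u
  have hM := hS.isNonnegSqrt_absOp
  have hsymm := isFormalAdjoint_of_isSelfAdjoint hM.isSelfAdjoint
  have hu := (absOp S).mem_graph u
  obtain ⟨w, hw⟩ := hS.exists_mem_absOp_graph u
  have hmem : ((u : H) - (ε : ℂ) • w, absOp S u - (ε : ℂ) • (u : H)) ∈ (absOp S).graph :=
    sub_mem hu (Submodule.smul_mem _ (ε : ℂ) hw)
  have h0 := hM.nonneg.le_inner hmem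
  have h1 : ⟪w, absOp S u⟫_ℂ = ⟪(u : H), u⟫_ℂ :=
    (inner_graph_of_isFormalAdjoint hsymm hw hu).symm
  have h2 : (⟪(u : H), u⟫_ℂ).re = ‖(u : H)‖ ^ 2 := (norm_sq_eq_re_inner (𝕜 := ℂ) (u : H)).symm
  have h3 : (⟪w, (u : H)⟫_ℂ).re ≤ ‖w‖ * ‖(u : H)‖ :=
    (Complex.re_le_norm _).trans (norm_inner_le_norm _ _)
  have h4 := hS.norm_le_of_mem_absOp_graph hw
  simp only [zero_mul, inner_sub_left, inner_sub_right, inner_smul_left, inner_smul_right, Complex.conj_ofReal, h1, Complex.sub_re,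
    Complex.re_ofReal_mul, h2] at h0
  have h5 : ε * (ε * (⟪w, (u : H)⟫_ℂ).re) ≤ ε * (‖(u : H)‖ * ‖(u : H)‖) := by
    refine mul_le_mul_of_nonneg_left ?_ hS.eps_pos.le
    calc ε * (⟪w, (u : H)⟫_ℂ).re ≤ ε * (‖w‖ * ‖(u : H)‖) :=
          mul_le_mul_of_nonneg_left h3 hS.eps_pos.le
      _ = ε * ‖w‖ * ‖(u : H)‖ := by ring
      _ ≤ ‖(u : H)‖ * ‖(u : H)‖ := mul_le_mul_of_nonneg_right h4 (norm_nonneg _)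
  nlinarith

theorem IsStrictlyPositive.ker_absOp (hS : IsStrictlyPositive S ε) :
    LinearMap.ker (absOp S).toFun = ⊥ := by
  refine ker_toFun_eq_bot fun x hx => ?_
  obtain ⟨p, hp, hn⟩ := hS.mem_graph_of_mem_absOp_graph hx
  rw [norm_zero, norm_eq_zero] at hn
  exact hS.eq_zero_of_mem_graph (hn ▸ hp)

theorem IsStrictlyPositive.mem_absOp_inverse_graph (hS : IsStrictlyPositive S ε) {x y : H} :
    (y, x) ∈ (absOp S).inverse.graph ↔ (x, y) ∈ (absOp S).graph :=
  swap_mem_inverse_graph hS.ker_absOp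

theorem IsStrictlyPositive.absOp_inverse_domain (hS : IsStrictlyPositive S ε) :
    (absOp S).inverse.domain = ⊤ := by
  refine (Submodule.eq_top_iff').2 fun k => ?_
  obtain ⟨x, hx⟩ := hS.exists_mem_absOp_graph k
  exact LinearPMap.mem_domain_of_mem_graph (hS.mem_absOp_inverse_graph.2 hx)

/-- The unitary map `|S| u ↦ u` from `H` onto `W`; that it is isometric is the identity
`‖|S| u‖ = ‖S u‖`. -/
theorem IsStrictlyPositive.exists_absInvEquiv (hS : IsStrictlyPositive S ε) :
    ∃ V : H ≃ₗᵢ[ℂ] FormSpace hS, ∀ h, (FormSpace.embed hS (V h), h) ∈ (absOp S).graph := by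
  have hdom : ∀ w : FormSpace hS, FormSpace.toH hS w ∈ (absOp S).domain := fun w =>
    (hS.mem_absOp_graph_of_mem w.mem_graph).elim fun q hq =>
      LinearPMap.mem_domain_of_mem_graph hq.1
  let m : FormSpace hS →ₗ[ℂ] H :=
    (absOp S).toFun ∘ₗ (FormSpace.toH hS).codRestrict (absOp S).domain hdom
  have hm : ∀ w, (FormSpace.embed hS w, m w) ∈ (absOp S).graph := fun w =>
    (absOp S).mem_graph ⟨_, hdom w⟩
  let V₀ : FormSpace hS ≃ₗᵢ[ℂ] H := LinearIsometryEquiv.ofSurjective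
    { toLinearMap := m
      norm_map' := fun w => by
        obtain ⟨q, hq, hn⟩ := hS.mem_absOp_graph_of_mem w.mem_graph
        rw [(absOp S).mem_graph_snd_inj (hm w) hq rfl, hn]
        exact (FormSpace.norm_def w).symm } (fun k => by
    obtain ⟨x, hx⟩ := hS.exists_mem_absOp_graph k
    obtain ⟨p, hp, -⟩ := hS.mem_graph_of_mem_absOp_graph hx
    obtain ⟨w, hw, -⟩ := (LinearPMap.mem_graph_iff S).1 hp
    exact ⟨w, (absOp S).mem_graph_snd_inj (hm w) hx hw⟩)
  refine ⟨V₀.symm, fun h => ?_⟩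
  have := hm (V₀.symm h)
  rwa [show m (V₀.symm h) = h from V₀.apply_symm_apply h] at this

/-- With the unitary `V = |S|⁻¹ : H → W` and the embedding `ι : W → H`, the polar factor is
`U = Ŝ V` and `|S|⁻¹ S |S|⁻¹ = ι V S V`. For `w = V h`, the vector `T w` satisfies
`(V a, T w)_W = (V a, S w)_H = (a, V (S w))_H`, that is `T w = V (ι (V (S w)))`. -/
theorem IsStrictlyPositive.exists_polar (hS : IsStrictlyPositive S ε) :
    ∃ (U : H ≃ₗᵢ[ℂ] HatSpace S) (B : H →L[ℂ] H),
      S = ((HatSpace S).subtype ∘ₗ U.toLinearEquiv.toLinearMap).compPMap (absOp S) ∧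
      B.toLinearMap.toPMap ⊤ =
        mulOp (absOp S).inverse (mulOp S (absOp S).inverse) ∧
      IsSelfAdjoint B ∧
      (reducedOp S (kreinOp S)).inverse =
        (U.toLinearEquiv.toLinearMap ∘ₗ B.toLinearMap ∘ₗ
          U.symm.toLinearEquiv.toLinearMap).toPMap ⊤ := by
  obtain ⟨V, hV⟩ := hS.exists_absInvEquiv
  have hsymm := isFormalAdjoint_of_isSelfAdjoint hS.isNonnegSqrt_absOp.isSelfAdjoint
  let ι := FormSpace.embed hS
  let L := FormSpace.opL hS
  let B : H →L[ℂ] H := ι ∘L (V : H →L[ℂ] FormSpace hS) ∘L L ∘L (V : H →L[ℂ] FormSpace hS)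
  have hB : ∀ h, B h = ι (V (L (V h))) := fun h => rfl
  have hVsymm : ∀ a b, ⟪a, ι (V b)⟫_ℂ = ⟪ι (V a), b⟫_ℂ := fun a b =>
    inner_graph_of_isFormalAdjoint hsymm (hV a) (hV b)
  have hBT : ∀ h, V (B h) = bucklingOp hS (V h) := fun h => by
    refine ext_inner_left ℂ fun v => ?_
    obtain ⟨a, rfl⟩ := V.surjective v
    rw [inner_bucklingOp, V.inner_map_map, hB, hVsymm]
  refine ⟨V.trans hS.hatEquiv, B, ?_, ?_, ?_, ?_⟩
  · refine eq_of_mem_graph_iff fun x y => ?_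
    have hVx : ∀ {q}, (x, q) ∈ (absOp S).graph → ι (V q) = x := fun {q} hq =>
      (absOp S).inverse.mem_graph_snd_inj (hS.mem_absOp_inverse_graph.2 (hV q))
        (hS.mem_absOp_inverse_graph.2 hq) rfl
    have hL : ∀ {q}, (x, q) ∈ (absOp S).graph → (x, L (V q)) ∈ S.graph := fun {q} hq => by
      have := (V q).mem_graph
      rwa [show FormSpace.embed hS (V q) = x from hVx hq] at this
    constructor
    · intro h
      obtain ⟨q, hq, -⟩ := hS.mem_absOp_graph_of_mem h
      obtain rfl : L (V q) = y := S.mem_graph_snd_inj (hL hq) h rfl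
      obtain ⟨x', rfl, rfl⟩ := (LinearPMap.mem_graph_iff _).1 hq
      exact (LinearPMap.mem_graph_iff _).2 ⟨x', rfl, rfl⟩
    · intro h
      obtain ⟨x', rfl, rfl⟩ := (LinearPMap.mem_graph_iff _).1 h
      exact hL ((absOp S).mem_graph x')
  · refine (eq_toPMap_top_of_mem_graph fun h => ?_).symm
    exact mem_mulOp_graph.2 ⟨L (V h), mem_mulOp_graph.2 ⟨ι (V h),
      hS.mem_absOp_inverse_graph.2 (hV h), (V h).mem_graph⟩,
      hS.mem_absOp_inverse_graph.2 (hV (L (V h)))⟩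
  · refine ContinuousLinearMap.isSelfAdjoint_iff_isSymmetric.2 fun a b => ?_
    change ⟪B a, b⟫_ℂ = ⟪a, B b⟫_ℂ
    rw [hB, hB, hVsymm, ← hVsymm]
    exact inner_graph_of_isFormalAdjoint hS.symmetric (V a).mem_graph (V b).mem_graph
  · refine eq_toPMap_top_of_mem_graph fun y => (swap_mem_inverse_graph hS.ker_reducedOp).2 ?_
    obtain ⟨h, rfl⟩ := (V.trans hS.hatEquiv).surjective y
    have h1 := hS.mem_reducedOp_graph_hatEquiv (V h)
    rw [← hBT] at h1
    change (hS.hatEquiv (V (B ((V.trans hS.hatEquiv).symm (V.trans hS.hatEquiv h)))), _) ∈ _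
    rw [LinearIsometryEquiv.symm_apply_apply]
    exact h1

end AbsoluteValue

end KreinBuckling

theorem theorem3p4 {H : Type*} [NormedAddCommGroup H] [InnerProductSpace ℂ H] [CompleteSpace H]
    (S : H →ₗ.[ℂ] H) (ε : ℝ) (hS : KreinBuckling.IsStrictlyPositive S ε) :
    -- the Krein–von Neumann extension of `S` exists and is unique
    (∃! SK : H →ₗ.[ℂ] H, KreinBuckling.IsKreinVonNeumannExtension S SK) ∧
    ∀ SK : H →ₗ.[ℂ] H, KreinBuckling.IsKreinVonNeumannExtension S SK →
      -- the reduced operator is the restriction of `SK` to `Ĥ = (ker SK)ᗮ`, and is injective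
      KreinBuckling.kerOp SK = KreinBuckling.kerOp S.adjoint ∧
      (∀ (x : (KreinBuckling.reducedOp S SK).domain) (hx : ((x : KreinBuckling.HatSpace S) : H) ∈
          SK.domain), (KreinBuckling.reducedOp S SK x : H) = SK ⟨_, hx⟩) ∧
      LinearMap.ker (KreinBuckling.reducedOp S SK).toFun = ⊥ ∧
      -- the buckling operator `T` is bounded, self-adjoint and nonnegative
      (KreinBuckling.bucklingOp hS).IsPositive ∧
      -- `Ŝ : W → Ĥ`, `w ↦ S w`, is unitary, and the inverse of the reduced operator,
      -- which is defined on all of `Ĥ`, equals `Ŝ T Ŝ⁻¹`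
      (∃ Shat : KreinBuckling.FormSpace hS ≃ₗᵢ[ℂ] KreinBuckling.HatSpace S,
        (∀ w, (Shat w : H) = KreinBuckling.FormSpace.opL hS w) ∧
        (KreinBuckling.reducedOp S SK).inverse =
          (Shat.toLinearEquiv.toLinearMap ∘ₗ (KreinBuckling.bucklingOp hS).toLinearMap ∘ₗ
            Shat.symm.toLinearEquiv.toLinearMap).toPMap ⊤) ∧
      -- `|S| = (S* S)^{1/2} ≥ ε I`, with an inverse defined on all of `H`
      KreinBuckling.IsNonnegSqrt (KreinBuckling.mulOp S.adjoint S) (KreinBuckling.absOp S) ∧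
      KreinBuckling.BoundedBelowBy (KreinBuckling.absOp S) ε ∧
      LinearMap.ker (KreinBuckling.absOp S).toFun = ⊥ ∧
      (KreinBuckling.absOp S).inverse.domain = ⊤ ∧
      -- the polar decomposition `S = U |S|` with `U : H → Ĥ` unitary, the bounded self-adjoint
      -- operator `B = |S|⁻¹ S |S|⁻¹` on `H`, and the inverse of the reduced operator is `U B U⁻¹`
      ∃ (U : H ≃ₗᵢ[ℂ] KreinBuckling.HatSpace S) (B : H →L[ℂ] H),
        S = ((KreinBuckling.HatSpace S).subtype ∘ₗ U.toLinearEquiv.toLinearMap).compPMap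
          (KreinBuckling.absOp S) ∧
        B.toLinearMap.toPMap ⊤ = KreinBuckling.mulOp (KreinBuckling.absOp S).inverse
          (KreinBuckling.mulOp S (KreinBuckling.absOp S).inverse) ∧
        IsSelfAdjoint B ∧
        (KreinBuckling.reducedOp S SK).inverse =
          (U.toLinearEquiv.toLinearMap ∘ₗ B.toLinearMap ∘ₗ
            U.symm.toLinearEquiv.toLinearMap).toPMap ⊤ := by
  refine ⟨⟨_, hS.isKreinVonNeumannExtension_kreinOp, fun K hK => hS.eq_kreinOp hK⟩,
    fun SK hSK => ?_⟩
  obtain rfl := hS.eq_kreinOp hSK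
  exact ⟨hS.kerOp_kreinOp, hS.reducedOp_apply, hS.ker_reducedOp, hS.isPositive_bucklingOp,
    ⟨hS.hatEquiv, hS.coe_hatEquiv, hS.inverse_reducedOp⟩, hS.isNonnegSqrt_absOp,
    hS.boundedBelowBy_absOp, hS.ker_absOp, hS.absOp_inverse_domain, hS.exists_polar⟩
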